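/- A poset is called $(2+2)$-free if it has no induced subposet isomorphic to the disjoint union of two $2$-element chains. For $n,k\ge 0$ let $p_n$ be the number of $(2+2)$-free posets on $n$ elements up to isomorphism, let $p_{n,k}$ be the number of those with exactly $k$ minimal elements, and put $$P(t)=\sum_{n\ge 0}p_n t^n\in\mathbb Z[[t]],\qquad P(t,z)=\sum_{n,k\ge 0}p_{n,k}\,t^n z^k\in\mathbb Z[[t,z]].$$ An ascent sequence of length $n$ is a sequence $(x_1,\dots,x_n)$ of natural numbers with $x_1=0$ and $0\le x_i\le 1+\mathrm{asc}(x_1,\dots,x_{i-1})$ for $2\le i\le n$, where $\mathrm{asc}(x_1,\dots,x_j)=|\{1\le m<j: x_m<x_{m+1}\}|$; the empty sequence is the ascent sequence of length $0$. Then: 1. For all $n,k\ge 0$, $p_n$ is the number of ascent sequences of length $n$, and $p_{n,k}$ is the number of ascent sequences of length $n$ with exactly $k$ zeros. 2. For every $n\ge 0$, the map $a_1\dots a_n\mapsto 0\,(a_1+1)\dots(a_n+1)$ is a bijection from the ascent sequences of length $n$ to the ascent sequences of length $n+1$ with exactly one zero. 3. As formal power series, $$P(t)=\frac1t\,\frac{\partial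 P(t,z)}{\partial z}\Big|_{z=0}=\sum_{n\ge 0}\ \prod_{i=1}^n\bigl(1-(1-t)^i\bigr).$$ -/

import Mathlib

open scoped PowerSeries.WithPiTopology

namespace TwoPlusTwo

/-- A poset is (2+2)-free if no induced subposet is isomorphic to the disjoint union of two
2-element chains. (The order on the type `Fin 2 ⊕ Fin 2` is the disjoint one.) -/
def IsFree (α : Type) [PartialOrder α] : Prop :=
  IsEmpty ((Fin 2 ⊕ Fin 2) ↪o α)

/-- The number of minimal elements of a poset. -/
noncomputable def numMin (α : Type) [PartialOrder α] : ℕ :=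
  Nat.card {x : α // IsMin x}

/-- Isomorphism of posets, restricted to the partial orders on `Fin n` with property `S`. -/
def isoSetoid (n : ℕ) (S : PartialOrder (Fin n) → Prop) :
    Setoid {P : PartialOrder (Fin n) // S P} where
  r P Q := Nonempty (@OrderIso (Fin n) (Fin n) P.1.toLE Q.1.toLE)
  iseqv :=
    { refl := fun P => ⟨@OrderIso.refl (Fin n) P.1.toLE⟩
      symm := fun {P Q} ⟨e⟩ => ⟨@OrderIso.symm (Fin n) (Fin n) P.1.toLE Q.1.toLE e⟩
      trans := fun {P Q R} ⟨e⟩ ⟨f⟩ =>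
        ⟨@OrderIso.trans (Fin n) (Fin n) (Fin n) P.1.toLE Q.1.toLE R.1.toLE e f⟩ }

/-- `p n`: the number of unlabeled (2+2)-free posets on `n` elements. -/
noncomputable def p (n : ℕ) : ℕ :=
  Nat.card (Quotient (isoSetoid n fun P => @IsFree (Fin n) P))

/-- `pMin n k`: the number of unlabeled (2+2)-free posets on `n` elements
with exactly `k` minimal elements. -/
noncomputable def pMin (n k : ℕ) : ℕ :=
  Nat.card (Quotient (isoSetoid n fun P => @IsFree (Fin n) P ∧ @numMin (Fin n) P = k))

/-- The number of ascents of a sequence of natural numbers. -/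
def asc (l : List ℕ) : ℕ :=
  ((Finset.range (l.length - 1)).filter fun j => l.getD j 0 < l.getD (j + 1) 0).card

/-- Ascent sequences (the empty sequence is one): the first entry is `0`, and each later entry
is at most one more than the number of ascents of the sequence that precedes it. -/
def IsAscentSeq (l : List ℕ) : Prop :=
  (∀ h : 0 < l.length, l[0] = 0) ∧
    ∀ (i : ℕ) (h : i < l.length), 1 ≤ i → l[i] ≤ 1 + asc (l.take i)

/-- The set of ascent sequences of length `n`. -/
def ascentSeqs (n : ℕ) : Set (List ℕ) :=
  {l | IsAscentSeq l ∧ l.length = n}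

/-- The set of ascent sequences of length `n` with exactly `k` zeros. -/
def ascentSeqsZeros (n k : ℕ) : Set (List ℕ) :=
  {l | IsAscentSeq l ∧ l.length = n ∧ l.count 0 = k}

/-- The map sending `a` to `0a⁺`. -/
def zeroShift (a : List ℕ) : List ℕ :=
  0 :: a.map (· + 1)

/-- The generating function `P(t) = ∑ₙ pₙ tⁿ`. -/
noncomputable def genP : PowerSeries ℤ :=
  PowerSeries.mk fun n => (p n : ℤ)

/-- The generating function `P(t, z) = ∑ pₙₖ tⁿ zᵏ`, as an element of `ℤ⟦t⟧⟦z⟧`: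
the outer variable is `z`, the inner variable is `t`. -/
noncomputable def genPz : PowerSeries (PowerSeries ℤ) :=
  PowerSeries.mk fun k => PowerSeries.mk fun n => (pMin n k : ℤ)

end TwoPlusTwo

namespace TwoPlusTwo

/-! A (2+2)-free poset is an interval order: its strict down-sets form a chain, and ranking them
yields intervals `[f x, g x]` for which every value below `d` is both a left and a right endpoint.
Such a representation is unique (`IsRep.left_unique`, `IsRep.right_unique`), so the multiset of
pairs `(f x, g x)`, a Fishburn matrix, classifies the poset up to isomorphism, and its row 0 counts
the minimal elements (`card_quotient_isoSetoid`).

Fishburn matrices grow one unit at a time. Let `i` be the topmost row meeting the last column. Each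
`l ≤ d` gives one matrix of index `l`: for `l ≤ i` a unit is added to the last column; for `l > i` a
row is also inserted and the last column is split, raising `d` by one. Thus the index is the last
letter of a sequence, `d` is one more than its number of ascents, and `l ≤ d` is the ascent
condition (`foldl_codeStep`, `code_bijOn`). The derivative identity then follows from
`zeroShift_bijOn`.

For the series, matrices are filled column by column and zero rows are excluded by
inclusion-exclusion. Let `G_a` be the signed series with `a` unconstrained rows, summed over all
dimensions. For `a ≥ 1` it satisfies `G_a = w_a (G_{a-1} - G_a)` with `w_a = (1-t)^{-a} - 1`, so
`G_a = (1-(1-t)^a) G_{a-1}`, which gives the product. `X_pow_dvd_sum_signedGen_sub` carries this out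
modulo powers of `t`. -/

/-- An upper triangular matrix of natural numbers of dimension `d` without zero rows or columns,
encoded as the multiset of its positions, each repeated according to its entry. -/
structure IsFishburn (d : ℕ) (M : Multiset (ℕ × ℕ)) : Prop where
  le : ∀ a b, (a, b) ∈ M → a ≤ b
  lt : ∀ a b, (a, b) ∈ M → b < d
  row : ∀ a < d, ∃ b, (a, b) ∈ M
  col : ∀ b < d, ∃ a, (a, b) ∈ M

/-- The intervals `[f x, g x]` form the minimal representation of the interval order `r`. -/
structure IsRep {α : Type} (r : α → α → Prop) (d : ℕ) (f g : α → ℕ) : Prop where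
  rel : ∀ x y, r x y ↔ g x < f y
  le : ∀ x, f x ≤ g x
  lt : ∀ x, g x < d
  surj_left : ∀ c < d, ∃ x, f x = c
  surj_right : ∀ c < d, ∃ x, g x = c

/-! ### Uniqueness of minimal interval representations -/

section Rep

variable {α : Type} {r : α → α → Prop} {d d' : ℕ} {f g f' g' : α → ℕ}

/-- Right endpoints take every value, so if `f y < f x` some `u` ends exactly at `f y`; it lies
below `x` but not below `y`. Hence the order alone decides how left endpoints compare. -/
theorem IsRep.left_le_iff (h : IsRep r d f g) (x y : α) :
    f x ≤ f y ↔ ∀ u, r u x → r u y := by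
  constructor
  · intro hxy u hu
    rw [h.rel] at hu ⊢
    omega
  · intro H
    by_contra! hlt
    obtain ⟨u, hu⟩ := h.surj_right (f y) ((h.le y).trans_lt (h.lt y))
    have := H u ((h.rel u x).2 (by omega))
    rw [h.rel] at this
    omega

/-- Left endpoints skip no value: an element at `c + 1` lies strictly to the right of one at `c`,
and this strictness passes to the other representation. -/
theorem IsRep.left_le (h : IsRep r d f g) (h' : IsRep r d' f' g') (x : α) : f x ≤ f' x := by
  induction hc : f x generalizing x with
  | zero => omega
  | succ c ih =>
    obtain ⟨y, hy⟩ := h.surj_left c (by have := h.le x; have := h.lt x; omega)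
    have h1 := ih y hy
    have h2 : ¬ f x ≤ f y := by omega
    rw [h.left_le_iff, ← h'.left_le_iff] at h2
    omega

theorem IsRep.left_unique (h : IsRep r d f g) (h' : IsRep r d' f' g') : f = f' :=
  funext fun x => le_antisymm (h.left_le h' x) (h'.left_le h x)

theorem IsRep.dim_le (h : IsRep r d f g) (h' : IsRep r d' f' g') : d ≤ d' := by
  cases d with
  | zero => omega
  | succ c =>
    obtain ⟨x, hx⟩ := h.surj_left c (by omega)
    have := h.left_le h' x
    have := h'.le x
    have := h'.lt x
    omega

/-- An `x` starting exactly at `g y` is not above `y`; since left endpoints agree, `g' y < g y`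
would put it above. -/
theorem IsRep.right_le (h : IsRep r d f g) (h' : IsRep r d' f' g') (y : α) : g y ≤ g' y := by
  by_contra! hlt
  obtain ⟨x, hx⟩ := h.surj_left (g y) (h.lt y)
  have h1 : f x = f' x := congrFun (h.left_unique h') x
  have h2 := (h'.rel y x).2 (by omega)
  rw [h.rel] at h2
  omega

theorem IsRep.right_unique (h : IsRep r d f g) (h' : IsRep r d' f' g') : g = g' :=
  funext fun x => le_antisymm (h.right_le h' x) (h'.right_le h x)

theorem IsRep.comp {β : Type} {s : β → β → Prop} (h : IsRep r d f g) (e : β ≃ α)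
    (he : ∀ x y, s x y ↔ r (e x) (e y)) : IsRep s d (f ∘ e) (g ∘ e) where
  rel x y := by rw [he, h.rel]; rfl
  le x := h.le _
  lt x := h.lt _
  surj_left c hc := by
    obtain ⟨x, hx⟩ := h.surj_left c hc
    exact ⟨e.symm x, by simpa using hx⟩
  surj_right c hc := by
    obtain ⟨x, hx⟩ := h.surj_right c hc
    exact ⟨e.symm x, by simpa using hx⟩

theorem IsRep.isFishburn [Fintype α] (h : IsRep r d f g) :
    IsFishburn d (Finset.univ.val.map fun x => (f x, g x)) where
  le a b hab := by
    obtain ⟨x, -, hx⟩ := Multiset.mem_map.1 hab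
    cases hx
    exact h.le x
  lt a b hab := by
    obtain ⟨x, -, hx⟩ := Multiset.mem_map.1 hab
    cases hx
    exact h.lt x
  row a ha := by
    obtain ⟨x, hx⟩ := h.surj_left a ha
    exact ⟨g x, Multiset.mem_map.2 ⟨x, Finset.mem_univ x, by rw [hx]⟩⟩
  col b hb := by
    obtain ⟨x, hx⟩ := h.surj_right b hb
    exact ⟨f x, Multiset.mem_map.2 ⟨x, Finset.mem_univ x, by rw [hx]⟩⟩

end Rep

/-! ### (2+2)-free posets are interval orders -/

section Order

variable {α : Type} [PartialOrder α]

theorem IsRep.isFree {d : ℕ} {f g : α → ℕ} (h : IsRep (α := α) (· < ·) d f g) : IsFree α := by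
  refine ⟨fun e => ?_⟩
  have h1 : e (Sum.inl 0) < e (Sum.inl 1) := by simp
  have h2 : e (Sum.inr 0) < e (Sum.inr 1) := by simp
  have h3 : ¬ e (Sum.inl 0) < e (Sum.inr 1) := by simp
  have h4 : ¬ e (Sum.inr 0) < e (Sum.inl 1) := by simp
  rw [h.rel] at h1 h2 h3 h4
  omega

theorem IsRep.isMin_iff {d : ℕ} {f g : α → ℕ} (h : IsRep (α := α) (· < ·) d f g) (x : α) :
    IsMin x ↔ f x = 0 := by
  rw [isMin_iff_forall_not_lt]
  constructor
  · intro hx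
    by_contra h0
    obtain ⟨y, hy⟩ := h.surj_right 0 (by have := h.lt x; omega)
    exact hx y ((h.rel y x).2 (by omega))
  · intro hx y hy
    rw [h.rel] at hy
    omega

theorem IsRep.numMin_eq [Fintype α] {d : ℕ} {f g : α → ℕ}
    (h : IsRep (α := α) (· < ·) d f g) :
    numMin α = (Finset.univ.val.map fun x => (f x, g x)).countP fun q => q.1 = 0 := by
  classical
  rw [numMin, Multiset.countP_map, Nat.card_congr (Equiv.subtypeEquivRight h.isMin_iff),
    Nat.card_eq_fintype_card, Fintype.card_subtype]
  rfl

theorem IsFree.chain (hα : IsFree α) {u v x y : α} (hux : u < x) (hvy : v < y) :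
    u < y ∨ v < x := by
  by_contra! H
  obtain ⟨h1, h2⟩ := H
  have huy : ¬ u ≤ y := fun h => by
    rcases h.eq_or_lt with rfl | h
    · exact h2 (hvy.trans hux)
    · exact h1 h
  have hvx : ¬ v ≤ x := fun h => by
    rcases h.eq_or_lt with rfl | h
    · exact h1 (hux.trans hvy)
    · exact h2 h
  refine hα.false (OrderEmbedding.ofMapLEIff (Sum.elim ![u, x] ![v, y]) ?_)
  have e1 : ¬ u ≤ v := fun h => huy (h.trans hvy.le)
  have e2 : ¬ v ≤ u := fun h => hvx (h.trans hux.le)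
  have e3 : ¬ x ≤ v := fun h => e1 (hux.le.trans h)
  have e4 : ¬ x ≤ y := fun h => huy (hux.le.trans h)
  have e5 : ¬ y ≤ u := fun h => e2 (hvy.le.trans h)
  have e6 : ¬ y ≤ x := fun h => hvx (hvy.le.trans h)
  rintro (a | a) (b | b) <;> fin_cases a <;> fin_cases b <;>
    simp [hux.le, hvy.le, hux.not_ge, hvy.not_ge, huy, hvx, e1, e2, e3, e4, e5, e6]

theorem IsFree.exists_isRep [Fintype α] (hα : IsFree α) :
    ∃ (d : ℕ) (f g : α → ℕ), IsRep (α := α) (· < ·) d f g := by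
  classical
  let D : α → Finset α := fun x => Finset.univ.filter (· < x)
  have memD : ∀ u x, u ∈ D x ↔ u < x := fun u x => by simp [D]
  let C : Finset (Finset α) := Finset.univ.image D
  have DC : ∀ x, D x ∈ C := fun x => Finset.mem_image_of_mem D (Finset.mem_univ x)
  have chain : ∀ E ∈ C, ∀ F ∈ C, E ⊆ F ∨ F ⊂ E := by
    intro E hE F hF
    obtain ⟨x, -, rfl⟩ := Finset.mem_image.1 hE
    obtain ⟨y, -, rfl⟩ := Finset.mem_image.1 hF
    by_contra! H
    obtain ⟨h1, h2⟩ := H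
    have h3 : ¬ D y ⊆ D x := fun h => h2 (Finset.ssubset_iff_subset_ne.2 ⟨h, fun he => h1 he.ge⟩)
    obtain ⟨u, hu, hu'⟩ := Finset.not_subset.1 h1
    obtain ⟨v, hv, hv'⟩ := Finset.not_subset.1 h3
    rw [memD] at hu hu' hv hv'
    rcases hα.chain hu hv with h | h
    · exact hu' h
    · exact hv' h
  let rk : Finset α → ℕ := fun E => (C.filter (· ⊂ E)).card
  have rk_lt : ∀ E ∈ C, ∀ F, E ⊂ F → rk E < rk F := by
    intro E hE F hEF
    refine Finset.card_lt_card (Finset.ssubset_iff_subset_ne.2 ⟨fun G hG => ?_, fun he => ?_⟩)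
    · rw [Finset.mem_filter] at hG ⊢
      exact ⟨hG.1, hG.2.trans hEF⟩
    · have : E ∈ C.filter (· ⊂ F) := Finset.mem_filter.2 ⟨hE, hEF⟩
      rw [← he] at this
      exact (Finset.mem_filter.1 this).2.ne rfl
  have rk_card : ∀ E ∈ C, rk E < C.card := by
    intro E hE
    refine Finset.card_lt_card (Finset.ssubset_iff_subset_ne.2
      ⟨Finset.filter_subset _ _, fun he => ?_⟩)
    rw [← he] at hE
    exact (Finset.mem_filter.1 hE).2.ne rfl
  have rk_surj : ∀ c < C.card, ∃ x, rk (D x) = c := by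
    have h1 : C.image rk = Finset.range C.card := by
      refine Finset.eq_of_subset_of_card_le (fun c hc => ?_) ?_
      · obtain ⟨E, hE, rfl⟩ := Finset.mem_image.1 hc
        exact Finset.mem_range.2 (rk_card E hE)
      · rw [Finset.card_range, Finset.card_image_of_injOn (s := C) (f := rk)]
        intro E hE F hF hEF
        rcases chain E hE F hF with h | h
        · by_contra hne
          exact (rk_lt E hE F (Finset.ssubset_iff_subset_ne.2 ⟨h, hne⟩)).ne hEF
        · exact absurd hEF (rk_lt F hF E h).ne'
    intro c hc
    rw [← Finset.mem_range, ← h1, Finset.mem_image] at hc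
    obtain ⟨E, hE, rfl⟩ := hc
    obtain ⟨x, -, rfl⟩ := Finset.mem_image.1 hE
    exact ⟨x, rfl⟩
  -- The members of the chain `C` that contain `y` are its largest ones, so `N y` is the rank from
  -- which `y` belongs to the down-sets.
  let N : α → ℕ := fun y => (C.filter (y ∉ ·)).card
  have N_pos : ∀ y, 0 < N y := fun y =>
    Finset.card_pos.2 ⟨D y, Finset.mem_filter.2 ⟨DC y, by simp [D]⟩⟩
  have rel : ∀ x y, x < y ↔ N x ≤ rk (D y) := by
    intro x y
    constructor
    · intro h
      refine Finset.card_le_card fun E hE => ?_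
      rw [Finset.mem_filter] at hE ⊢
      refine ⟨hE.1, (chain _ (DC y) _ hE.1).resolve_left fun h' => hE.2 (h' ((memD _ _).2 h))⟩
    · intro h
      by_contra hxy
      refine absurd h (not_le.2 (Finset.card_lt_card (Finset.ssubset_iff_subset_ne.2
        ⟨fun E hE => ?_, fun he => ?_⟩)))
      · rw [Finset.mem_filter] at hE ⊢
        exact ⟨hE.1, fun hx => hxy ((memD _ _).1 (hE.2.subset hx))⟩
      · have : D y ∈ C.filter (x ∉ ·) := Finset.mem_filter.2 ⟨DC y, by rwa [memD]⟩
        rw [← he] at this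
        exact (Finset.mem_filter.1 this).2.ne rfl
  have N_le : ∀ y, N y ≤ C.card := fun y => Finset.card_filter_le _ _
  refine ⟨C.card, fun x => rk (D x), fun y => N y - 1, ?_, ?_, ?_, rk_surj, ?_⟩
  · intro x y
    have := N_pos x
    rw [rel]
    omega
  · intro x
    have := (rel x x).not.1 (lt_irrefl x)
    omega
  · intro x
    have := N_pos x
    have := N_le x
    omega
  · intro c hc
    rcases Nat.lt_or_ge (c + 1) C.card with h | h
    · obtain ⟨x, hx⟩ := rk_surj c hc
      obtain ⟨y, hy⟩ := rk_surj (c + 1) h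
      have h1 : ¬ D y ⊆ D x := fun hs => by
        rcases eq_or_ssubset_of_subset hs with h2 | h2
        · rw [h2] at hy; omega
        · have := rk_lt _ (DC y) _ h2; omega
      obtain ⟨u, hu, hu'⟩ := Finset.not_subset.1 h1
      rw [memD, rel] at hu hu'
      exact ⟨u, by omega⟩
    -- The top value is attained by a maximal element, which lies in no down-set.
    · obtain ⟨x, -⟩ := rk_surj c hc
      obtain ⟨y, hy⟩ := (Set.toFinite (Set.univ : Set α)).exists_maximal ⟨x, trivial⟩
      refine ⟨y, ?_⟩
      have : N y = C.card := by
        refine congrArg Finset.card (Finset.filter_true_of_mem fun E hE => ?_)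
        obtain ⟨z, -, rfl⟩ := Finset.mem_image.1 hE
        rw [memD]
        exact fun h => hy.not_gt trivial h
      omega

end Order

/-! ### Isomorphism classes as Fishburn matrices -/

/-- The Fishburn matrices with sum of entries `n`. -/
def fishburnSet (n : ℕ) : Set (Multiset (ℕ × ℕ)) :=
  {M | M.card = n ∧ ∃ d, IsFishburn d M}

theorem exists_fin_map_eq {β : Type} {n : ℕ} (M : Multiset β) (hM : M.card = n) :
    ∃ F : Fin n → β, Finset.univ.val.map F = M := by
  subst hM
  induction M using Quotient.inductionOn with
  | h l =>
    refine ⟨l.get, ?_⟩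
    exact (Fin.univ_val_map _).trans (congrArg _ (List.ofFn_get l))

theorem map_univ_eq_iff {ι β : Type} [Fintype ι] (F G : ι → β) :
    Finset.univ.val.map F = Finset.univ.val.map G ↔ ∃ σ : Equiv.Perm ι, F = G ∘ σ := by
  classical
  constructor
  · intro h
    have hcard : ∀ (H : ι → β) (b : β),
        Fintype.card {x // H x = b} = (Finset.univ.val.map H).count b := by
      intro H b
      rw [Fintype.card_subtype, Multiset.count_map]
      simp only [eq_comm (a := b)]
      rfl
    let e : ∀ b, {x // F x = b} ≃ {x // G x = b} := fun b =>
      (Fintype.card_eq.1 (by rw [hcard, hcard, h])).some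
    refine ⟨(Equiv.sigmaFiberEquiv F).symm.trans
      ((Equiv.sigmaCongrRight e).trans (Equiv.sigmaFiberEquiv G)), funext fun x => ?_⟩
    exact ((e (F x)) ⟨x, rfl⟩).2.symm
  · rintro ⟨σ, rfl⟩
    rw [← Multiset.map_map, Multiset.map_univ_val_equiv]

theorem IsFishburn.exists_order {d n : ℕ} {M : Multiset (ℕ × ℕ)} (h : IsFishburn d M)
    (hM : M.card = n) : ∃ (P : PartialOrder (Fin n)) (f g : Fin n → ℕ),
      IsRep P.lt d f g ∧ Finset.univ.val.map (fun x => (f x, g x)) = M := by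
  obtain ⟨F, hF⟩ := exists_fin_map_eq M hM
  have mem : ∀ x, F x ∈ M := fun x => by
    rw [← hF]
    exact Multiset.mem_map_of_mem _ (Finset.mem_univ x)
  have ex : ∀ q ∈ M, ∃ x, F x = q := fun q hq => by
    rw [← hF, Multiset.mem_map] at hq
    obtain ⟨x, -, hx⟩ := hq
    exact ⟨x, hx⟩
  have le : ∀ x, (F x).1 ≤ (F x).2 := fun x => h.le _ _ (mem x)
  let P : PartialOrder (Fin n) :=
    { le := fun x y => x = y ∨ (F x).2 < (F y).1
      lt := fun x y => (F x).2 < (F y).1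
      le_refl := fun x => Or.inl rfl
      le_trans := by
        rintro x y z (rfl | h1) (rfl | h2)
        · exact Or.inl rfl
        · exact Or.inr h2
        · exact Or.inr h1
        · exact Or.inr (by have := le y; omega)
      lt_iff_le_not_ge := by
        intro x y
        constructor
        · intro h1
          refine ⟨Or.inr h1, ?_⟩
          rintro (rfl | h2)
          · have := le y; omega
          · have := le x; have := le y; omega
        · rintro ⟨rfl | h1, h2⟩
          · exact absurd (Or.inl rfl) h2
          · exact h1
      le_antisymm := by
        rintro x y (rfl | h1) (h2 | h2)
        · rfl
        · rfl
        · exact h2.symm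
        · have := le x; have := le y; omega }
  refine ⟨P, fun x => (F x).1, fun x => (F x).2, ⟨fun x y => Iff.rfl, le, fun x => h.lt _ _ (mem x),
    fun c hc => ?_, fun c hc => ?_⟩, hF⟩
  · obtain ⟨b, hb⟩ := h.row c hc
    obtain ⟨x, hx⟩ := ex _ hb
    exact ⟨x, by rw [hx]⟩
  · obtain ⟨b, hb⟩ := h.col c hc
    obtain ⟨x, hx⟩ := ex _ hb
    exact ⟨x, by rw [hx]⟩

/-- Uniqueness of the representation makes the matrix a complete invariant. The predicate `T` lets
one argument serve both with and without a prescribed number of minimal elements. -/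
theorem card_quotient_isoSetoid (n : ℕ) (S : PartialOrder (Fin n) → Prop)
    (T : Multiset (ℕ × ℕ) → Prop) (hS : ∀ P, S P → @IsFree (Fin n) P)
    (hT : ∀ (P : PartialOrder (Fin n)) (d : ℕ) (f g : Fin n → ℕ), IsRep P.lt d f g →
      (S P ↔ T (Finset.univ.val.map fun x => (f x, g x)))) :
    Nat.card (Quotient (isoSetoid n S)) = {M ∈ fishburnSet n | T M}.ncard := by
  have H : ∀ P : {P // S P}, ∃ (d : ℕ) (f g : Fin n → ℕ), IsRep P.1.lt d f g := fun P =>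
    @IsFree.exists_isRep (Fin n) P.1 _ (hS P.1 P.2)
  choose d f g hrep using H
  let code : {P // S P} → {M ∈ fishburnSet n | T M} := fun P =>
    ⟨Finset.univ.val.map fun x => (f P x, g P x),
      ⟨by simp, d P, (hrep P).isFishburn⟩, (hT P.1 _ _ _ (hrep P)).1 P.2⟩
  have code_iff : ∀ P Q, code P = code Q ↔ (isoSetoid n S).r P Q := by
    intro P Q
    constructor
    · intro h
      obtain ⟨σ, hσ⟩ := (map_univ_eq_iff (fun x => (f P x, g P x)) fun x => (f Q x, g Q x)).1
        (congrArg Subtype.val h)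
      have hf : ∀ x, f P x = f Q (σ x) := fun x => congrArg Prod.fst (congrFun hσ x)
      have hg : ∀ x, g P x = g Q (σ x) := fun x => congrArg Prod.snd (congrFun hσ x)
      refine ⟨RelIso.mk σ ?_⟩
      intro x y
      rw [@le_iff_lt_or_eq _ P.1, @le_iff_lt_or_eq _ Q.1]
      exact or_congr (((hrep Q).rel _ _).trans (by rw [← hf, ← hg]; exact ((hrep P).rel _ _).symm))
        σ.injective.eq_iff
    · rintro ⟨e⟩
      have h1 := (hrep Q).comp (s := P.1.lt) e.toEquiv
        (fun x y => (@OrderIso.lt_iff_lt _ _ P.1.toPreorder Q.1.toPreorder e x y).symm)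
      refine Subtype.ext ((map_univ_eq_iff _ _).2 ⟨e.toEquiv, ?_⟩)
      rw [(hrep P).left_unique h1, (hrep P).right_unique h1]
      rfl
  rw [← Nat.card_coe_set_eq]
  refine Nat.card_congr (Equiv.ofBijective
    (Quotient.lift code fun P Q h => (code_iff P Q).2 h) ⟨?_, ?_⟩)
  · rintro ⟨P⟩ ⟨Q⟩ h
    exact Quotient.sound ((code_iff P Q).1 h)
  · rintro ⟨M, ⟨hM, d₀, hd⟩, hTM⟩
    obtain ⟨P, f₀, g₀, h₀, rfl⟩ := hd.exists_order hM
    refine ⟨Quotient.mk _ ⟨P, (hT P _ _ _ h₀).2 hTM⟩, Subtype.ext ?_⟩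
    change Finset.univ.val.map (fun x => (f ⟨P, _⟩ x, g ⟨P, _⟩ x)) = _
    rw [← h₀.left_unique (hrep ⟨P, _⟩), ← h₀.right_unique (hrep ⟨P, _⟩)]

theorem p_eq_ncard (n : ℕ) : p n = (fishburnSet n).ncard := by
  have := card_quotient_isoSetoid n (fun P => @IsFree (Fin n) P) (fun _ => True) (fun _ h => h)
    (fun P d f g h => iff_of_true (@IsRep.isFree (Fin n) P d f g h) trivial)
  rw [p, this]
  simp

theorem pMin_eq_ncard (n k : ℕ) :
    pMin n k = {M ∈ fishburnSet n | (M.countP fun q => q.1 = 0) = k}.ncard :=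
  card_quotient_isoSetoid n _ _ (fun _ h => h.1) fun P d f g h => by
    rw [← @IsRep.numMin_eq (Fin n) P _ d f g h]
    exact and_iff_right (@IsRep.isFree (Fin n) P d f g h)

/-! ### Adding a unit of prescribed index -/

theorem IsFishburn.dim_le {d e : ℕ} {M : Multiset (ℕ × ℕ)} (h : IsFishburn d M)
    (h' : IsFishburn e M) : d ≤ e := by
  by_contra! hlt
  obtain ⟨b, hb⟩ := h.row e hlt
  have := h'.le _ _ hb
  have := h'.lt _ _ hb
  omega

theorem IsFishburn.dim_unique {d e : ℕ} {M : Multiset (ℕ × ℕ)} (h : IsFishburn d M)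
    (h' : IsFishburn e M) : d = e :=
  le_antisymm (h.dim_le h') (h'.dim_le h)

/-- A nonempty Fishburn matrix whose last column has its first nonzero entry in row `i`. -/
structure IsIndexed (d i : ℕ) (M : Multiset (ℕ × ℕ)) : Prop extends IsFishburn d M where
  mem : (i, d - 1) ∈ M
  min : ∀ a, (a, d - 1) ∈ M → i ≤ a

theorem IsIndexed.index_unique {d i j : ℕ} {M : Multiset (ℕ × ℕ)} (h : IsIndexed d i M)
    (h' : IsIndexed d j M) : i = j :=
  le_antisymm (h.min _ h'.mem) (h'.min _ h.mem)

theorem IsIndexed.lt_dim {d i : ℕ} {M : Multiset (ℕ × ℕ)} (h : IsIndexed d i M) : i < d :=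
  (h.le _ _ h.mem).trans_lt (h.lt _ _ h.mem)

theorem IsFishburn.exists_index {d : ℕ} {M : Multiset (ℕ × ℕ)} (h : IsFishburn d M)
    (hd : 0 < d) : ∃ i, IsIndexed d i M := by
  classical
  have ex := h.col (d - 1) (by omega)
  exact ⟨Nat.find ex, h, Nat.find_spec ex, fun a ha => Nat.find_min' ex ha⟩

/-- Relabelling of the positions of a matrix of dimension `d` when a new row `l` is inserted
and the entries of the last column above this row are moved into a column of their own. -/
def shift (d l : ℕ) (q : ℕ × ℕ) : ℕ × ℕ :=
  (if q.1 < l then q.1 else q.1 + 1,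
    if q.2 + 1 < d then if q.2 < l then q.2 else q.2 + 1
    -- For `l = d` the old last column stays at `d - 1`, leaving column `d` to the new unit alone.
    else if q.1 < l then min l (d - 1) else d)

/-- The inverse of `shift d l`. -/
def unshift (d l : ℕ) (q : ℕ × ℕ) : ℕ × ℕ :=
  if q.1 < l then (q.1, if q.2 < l then q.2 else if q.2 = l then d - 1 else q.2 - 1)
  else (q.1 - 1, q.2 - 1)

theorem unshift_shift {d l a b : ℕ} (hab : a ≤ b) (hb : b < d) (hl : l ≤ d) :
    unshift d l (shift d l (a, b)) = (a, b) := by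
  grind [shift, unshift]

theorem shift_unshift {d l a b : ℕ} (hab : a ≤ b) (hb : b ≤ d) (hl : l ≤ d) (ha : a ≠ l)
    (hd : b = d → l ≤ a) : shift d l (unshift d l (a, b)) = (a, b) := by
  grind [shift, unshift]

/-- Adding an element of index `l` to a matrix of dimension `d` and index `i`. -/
def addIndex (d i : ℕ) (M : Multiset (ℕ × ℕ)) (l : ℕ) : Multiset (ℕ × ℕ) :=
  if i < l then (l, d) ::ₘ M.map (shift d l) else (l, d - 1) ::ₘ M

section Add

variable {d i l : ℕ} {M : Multiset (ℕ × ℕ)}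

theorem mem_map_shift_iff {q : ℕ × ℕ} :
    q ∈ M.map (shift d l) ↔ ∃ a b, (a, b) ∈ M ∧ shift d l (a, b) = q := by
  simp

theorem IsIndexed.cons (h : IsIndexed d i M) (hl : l ≤ i) :
    IsIndexed d l ((l, d - 1) ::ₘ M) := by
  have := h.lt_dim
  refine ⟨⟨?_, ?_, ?_, ?_⟩, Multiset.mem_cons_self _ _, ?_⟩
  · intro a b hab
    rcases Multiset.mem_cons.1 hab with h1 | h1
    · simp only [Prod.mk.injEq] at h1
      omega
    · exact h.le _ _ h1
  · intro a b hab
    rcases Multiset.mem_cons.1 hab with h1 | h1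
    · simp only [Prod.mk.injEq] at h1
      omega
    · exact h.lt _ _ h1
  · intro a ha
    obtain ⟨b, hb⟩ := h.row a ha
    exact ⟨b, Multiset.mem_cons_of_mem hb⟩
  · intro a ha
    obtain ⟨b, hb⟩ := h.col a ha
    exact ⟨b, Multiset.mem_cons_of_mem hb⟩
  · intro a ha
    rcases Multiset.mem_cons.1 ha with h1 | h1
    · simp only [Prod.mk.injEq] at h1
      omega
    · exact hl.trans (h.min _ h1)

theorem IsIndexed.cons_shift (h : IsIndexed d i M) (hi : i < l) (hl : l ≤ d) :
    IsIndexed (d + 1) l ((l, d) ::ₘ M.map (shift d l)) := by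
  have hid := h.lt_dim
  have mem_shift : ∀ {a b}, (a, b) ∈ M → shift d l (a, b) ∈ (l, d) ::ₘ M.map (shift d l) :=
    fun hab => Multiset.mem_cons_of_mem (Multiset.mem_map_of_mem _ hab)
  have key : ∀ {a b}, (a, b) ∈ (l, d) ::ₘ M.map (shift d l) → (a = l ∧ b = d) ∨
      ∃ a' b', (a', b') ∈ M ∧ a' ≤ b' ∧ b' < d ∧ shift d l (a', b') = (a, b) := by
    intro a b hab
    rcases Multiset.mem_cons.1 hab with h1 | h1
    · exact Or.inl (Prod.mk.inj h1)
    · obtain ⟨a', b', h2, h3⟩ := mem_map_shift_iff.1 h1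
      exact Or.inr ⟨a', b', h2, h.le _ _ h2, h.lt _ _ h2, h3⟩
  refine ⟨⟨?_, ?_, ?_, ?_⟩, Multiset.mem_cons_self _ _, ?_⟩
  · intro a b hab
    rcases key hab with ⟨rfl, rfl⟩ | ⟨a', b', h2, h3, h4, h5⟩
    · exact hl
    · simp only [shift, Prod.mk.injEq] at h5
      obtain ⟨rfl, rfl⟩ := h5
      split_ifs <;> omega
  · intro a b hab
    rcases key hab with ⟨rfl, rfl⟩ | ⟨a', b', h2, h3, h4, h5⟩
    · omega
    · simp only [shift, Prod.mk.injEq] at h5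
      obtain ⟨rfl, rfl⟩ := h5
      split_ifs <;> omega
  · intro a ha
    rcases lt_trichotomy a l with h1 | rfl | h1
    · obtain ⟨b, hb⟩ := h.row a (by omega)
      have := mem_shift hb
      rw [shift, if_pos h1] at this
      exact ⟨_, this⟩
    · exact ⟨d, Multiset.mem_cons_self _ _⟩
    · obtain ⟨b, hb⟩ := h.row (a - 1) (by omega)
      have := mem_shift hb
      rw [shift, if_neg (by dsimp only; omega), Nat.sub_add_cancel (by omega)] at this
      exact ⟨_, this⟩
  · intro b hb
    have of_shift : ∀ {a' b'}, (a', b') ∈ M → (shift d l (a', b')).2 = b →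
        ∃ a, (a, b) ∈ (l, d) ::ₘ M.map (shift d l) := by
      intro a' b' h1 h2
      exact ⟨(shift d l (a', b')).1, by rw [← h2]; exact mem_shift h1⟩
    rcases Nat.lt_or_ge b d with hbd | hbd
    · rcases lt_trichotomy b l with h1 | h1 | h1
      · obtain ⟨a, ha⟩ := h.col b hbd
        have := h.le _ _ ha
        refine of_shift ha ?_
        simp only [shift]
        split_ifs <;> omega
      · refine of_shift h.mem ?_
        simp only [shift]
        split_ifs <;> omega
      · obtain ⟨a, ha⟩ := h.col (b - 1) (by omega)
        have := h.le _ _ ha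
        refine of_shift ha ?_
        simp only [shift]
        split_ifs <;> omega
    · obtain rfl : b = d := by omega
      exact ⟨l, Multiset.mem_cons_self _ _⟩
  · intro a ha
    rcases key ha with ⟨rfl, -⟩ | ⟨a', b', h2, h3, h4, h5⟩
    · exact le_rfl
    · simp only [shift, Prod.mk.injEq] at h5
      obtain ⟨rfl, h6⟩ := h5
      split_ifs at h6 ⊢ <;> omega

theorem IsIndexed.isIndexed_addIndex (h : IsIndexed d i M) (hl : l ≤ d) :
    IsIndexed (if i < l then d + 1 else d) l (addIndex d i M l) := by
  unfold addIndex
  split_ifs with hi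
  · exact h.cons_shift hi hl
  · exact h.cons (by omega)

theorem card_addIndex : (addIndex d i M l).card = M.card + 1 := by
  unfold addIndex
  split_ifs <;> simp

theorem countP_addIndex : ((addIndex d i M l).countP fun q => q.1 = 0) =
    (M.countP fun q => q.1 = 0) + if l = 0 then 1 else 0 := by
  unfold addIndex
  split_ifs with hi hl hl
  · omega
  · rw [Multiset.countP_cons_of_neg _ (by exact hl), Multiset.countP_map, add_zero,
      Multiset.countP_eq_card_filter]
    congr 1
    refine Multiset.filter_congr fun q _ => ?_
    grind [shift]
  · rw [Multiset.countP_cons_of_pos _ (by exact hl)]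
  · rw [Multiset.countP_cons_of_neg _ (by exact hl), add_zero]

/-- The index of the result is `l`, and row `l` reveals the branch: after a shift it holds only the
new unit, otherwise it holds another unit of the old matrix. Each branch is then invertible. -/
theorem addIndex_injective {d' i' l' : ℕ} {M' : Multiset (ℕ × ℕ)} (h : IsIndexed d i M)
    (h' : IsIndexed d' i' M') (hl : l ≤ d) (hl' : l' ≤ d')
    (heq : addIndex d i M l = addIndex d' i' M' l') : M = M' ∧ l = l' := by
  have mixed : ∀ {d d' i : ℕ} {M M' : Multiset (ℕ × ℕ)}, IsIndexed d i M → ¬ i < l →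
      (l, d - 1) ::ₘ M = (l, d') ::ₘ M'.map (shift d' l) → d = d' + 1 → False := by
    intro d d' i' M M' h hi heq hd
    subst hd
    rw [Nat.add_sub_cancel, Multiset.cons_inj_right] at heq
    obtain ⟨b, hb⟩ := h.row l (by have := h.lt_dim; omega)
    rw [heq, mem_map_shift_iff] at hb
    obtain ⟨a', b', -, h2⟩ := hb
    simp only [shift, Prod.mk.injEq] at h2
    obtain ⟨h2, -⟩ := h2
    split_ifs at h2 <;> omega
  have H := h.isIndexed_addIndex hl
  have H' := h'.isIndexed_addIndex hl'
  rw [← heq] at H'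
  have hdim := H.dim_unique H'.toIsFishburn
  rw [← hdim] at H'
  obtain rfl := H.index_unique H'
  refine ⟨?_, rfl⟩
  unfold addIndex at heq
  split_ifs at heq hdim with h1 h2 h2
  · obtain rfl : d = d' := by omega
    rw [Multiset.cons_inj_right] at heq
    have inv : ∀ {i : ℕ} {N : Multiset (ℕ × ℕ)}, IsIndexed d i N →
        (N.map (shift d l)).map (unshift d l) = N := by
      intro i N hN
      rw [Multiset.map_map]
      exact (Multiset.map_congr rfl fun q hq =>
        unshift_shift (hN.le _ _ hq) (hN.lt _ _ hq) hl).trans (Multiset.map_id N)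
    rw [← inv h, ← inv h', heq]
  · exact (mixed h' (by omega) heq.symm (by omega)).elim
  · exact (mixed h (by omega) heq (by omega)).elim
  · obtain rfl : d = d' := by omega
    exact (Multiset.cons_inj_right _).1 heq

end Add

/-! ### Removing a unit -/

section Remove

variable {d l : ℕ} {R : Multiset (ℕ × ℕ)}

/-- Only the last column could become empty. Row `d - 1` can meet nothing but the corner, which
keeps that column nonempty; if `l = d - 1`, the second unit of row `l` is in the corner. -/
theorem IsIndexed.of_cons (h : IsIndexed d l ((l, d - 1) ::ₘ R)) (hl : ∃ b, (l, b) ∈ R) :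
    ∃ i, IsIndexed d i R ∧ l ≤ i := by
  have hld := h.lt_dim
  have mem : ∀ {a b}, (a, b) ∈ (l, d - 1) ::ₘ R → ¬ (a = l ∧ b = d - 1) → (a, b) ∈ R := by
    intro a b hab hne
    rcases Multiset.mem_cons.1 hab with h1 | h1
    · exact absurd (Prod.mk.inj h1) hne
    · exact h1
  have hR : IsFishburn d R := by
    refine ⟨fun a b hab => h.le _ _ (Multiset.mem_cons_of_mem hab),
      fun a b hab => h.lt _ _ (Multiset.mem_cons_of_mem hab), fun a ha => ?_, fun b hb => ?_⟩
    · by_cases hal : a = l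
      · rwa [hal]
      · obtain ⟨b, hb⟩ := h.row a ha
        exact ⟨b, mem hb (by omega)⟩
    · by_cases hbd : b = d - 1
      · by_cases hl' : l = d - 1
        · obtain ⟨c, hc⟩ := hl
          have h1 := h.le _ _ (Multiset.mem_cons_of_mem hc)
          have h2 := h.lt _ _ (Multiset.mem_cons_of_mem hc)
          obtain rfl : c = b := by omega
          exact ⟨l, hc⟩
        · obtain ⟨c, hc⟩ := h.row (d - 1) (by omega)
          have h1 := h.le _ _ hc
          have h2 := h.lt _ _ hc
          obtain rfl : c = b := by omega
          exact ⟨d - 1, mem hc (by omega)⟩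
      · obtain ⟨a, ha⟩ := h.col b hb
        exact ⟨a, mem ha (by omega)⟩
  obtain ⟨i, hi⟩ := hR.exists_index (by omega)
  exact ⟨i, hi, h.min _ (Multiset.mem_cons_of_mem hi.mem)⟩

/-- A row `l` without a second unit comes from a shift, undone by merging the split column back. The
condition `R ≠ 0` excludes the matrix with a single unit and forces `e > 0`. -/
theorem IsIndexed.of_cons_unshift {e : ℕ} (h : IsIndexed (e + 1) l ((l, e) ::ₘ R))
    (hR : R ≠ 0) (hl : ∀ b, (l, b) ∉ R) :
    ∃ i, IsIndexed e i (R.map (unshift e l)) ∧ i < l ∧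
      (R.map (unshift e l)).map (shift e l) = R := by
  have hld := h.lt_dim
  have bound : ∀ {a b}, (a, b) ∈ R → a ≠ l ∧ a ≤ b ∧ b ≤ e ∧ (b = e → l ≤ a) := by
    intro a b hab
    have h1 : (a, b) ∈ (l, e) ::ₘ R := Multiset.mem_cons_of_mem hab
    refine ⟨?_, h.le _ _ h1, by have := h.lt _ _ h1; omega, ?_⟩
    · rintro rfl
      exact hl _ hab
    · rintro rfl
      exact h.min _ h1
  have mem : ∀ {a b}, (a, b) ∈ (l, e) ::ₘ R → ¬ (a = l ∧ b = e) → (a, b) ∈ R := by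
    intro a b hab hne
    rcases Multiset.mem_cons.1 hab with h1 | h1
    · exact absurd (Prod.mk.inj h1) hne
    · exact h1
  have he : 0 < e := by
    obtain ⟨⟨a, b⟩, hab⟩ := Multiset.exists_mem_of_ne_zero hR
    have := bound hab
    omega
  have of_mem : ∀ {a b a' b'}, (a, b) ∈ R → unshift e l (a, b) = (a', b') →
      (a', b') ∈ R.map (unshift e l) := by
    intro a b a' b' hab h1
    rw [← h1]
    exact Multiset.mem_map_of_mem _ hab
  -- Column `l`, or column `e - 1` if `l = e`, has an entry strictly above row `l`. It ends up in
  -- the last column and forces the recovered index below `l`.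
  have last : ∃ a < l, (a, e - 1) ∈ R.map (unshift e l) := by
    by_cases hle : l < e
    · obtain ⟨a, ha⟩ := h.col l (by omega)
      have ha := mem ha (by omega)
      have := bound ha
      exact ⟨a, by omega, of_mem ha (by grind [unshift])⟩
    · obtain ⟨a, ha⟩ := h.col (e - 1) (by omega)
      have ha := mem ha (by omega)
      have := bound ha
      exact ⟨a, by omega, of_mem ha (by grind [unshift])⟩
  have fish : IsFishburn e (R.map (unshift e l)) := by
    have key : ∀ {a b}, (a, b) ∈ R.map (unshift e l) → a ≤ b ∧ b < e := by
      intro a b hab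
      obtain ⟨⟨a', b'⟩, h1, h2⟩ := Multiset.mem_map.1 hab
      have := bound h1
      grind [unshift]
    refine ⟨fun a b hab => (key hab).1, fun a b hab => (key hab).2, fun a ha => ?_,
      fun b hb => ?_⟩
    · by_cases hal : a < l
      · obtain ⟨b, hb⟩ := h.row a (by omega)
        exact ⟨(unshift e l (a, b)).2, of_mem (mem hb (by omega)) (by grind [unshift])⟩
      · obtain ⟨b, hb⟩ := h.row (a + 1) (by omega)
        exact ⟨(unshift e l (a + 1, b)).2, of_mem (mem hb (by omega)) (by grind [unshift])⟩
    · by_cases hbe : b = e - 1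
      · obtain ⟨a, -, ha⟩ := last
        exact ⟨a, by rwa [hbe]⟩
      · by_cases hbl : b < l
        · obtain ⟨a, ha⟩ := h.col b (by omega)
          have ha := mem ha (by omega)
          have := bound ha
          exact ⟨a, of_mem ha (by grind [unshift])⟩
        · obtain ⟨a, ha⟩ := h.col (b + 1) (by omega)
          have ha := mem ha (by omega)
          have := bound ha
          exact ⟨(unshift e l (a, b + 1)).1, of_mem ha (by grind [unshift])⟩
  obtain ⟨i, hi⟩ := fish.exists_index he
  obtain ⟨a, hal, ha⟩ := last
  refine ⟨i, hi, (hi.min a ha).trans_lt hal, ?_⟩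
  rw [Multiset.map_map]
  refine (Multiset.map_congr rfl fun q hq => ?_).trans (Multiset.map_id R)
  obtain ⟨h1, h2, h3, h4⟩ := bound (a := q.1) (b := q.2) hq
  exact shift_unshift h2 h3 (by omega) h1 h4

theorem IsIndexed.exists_addIndex {B : Multiset (ℕ × ℕ)} (h : IsIndexed d l B)
    (hB : 2 ≤ B.card) :
    ∃ e i M, IsIndexed e i M ∧ l ≤ e ∧ addIndex e i M l = B := by
  obtain ⟨R, rfl⟩ := Multiset.exists_cons_of_mem h.mem
  have hld := h.lt_dim
  by_cases hl : ∃ b, (l, b) ∈ R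
  · obtain ⟨i, hi, hli⟩ := h.of_cons hl
    exact ⟨d, i, R, hi, by omega, if_neg (by omega)⟩
  · push Not at hl
    obtain ⟨e, rfl⟩ : ∃ e, d = e + 1 := ⟨d - 1, by omega⟩
    have hR : R ≠ 0 := by
      rintro rfl
      simp at hB
    obtain ⟨i, hi, hil, hmap⟩ := h.of_cons_unshift hR hl
    refine ⟨e, i, _, hi, by omega, ?_⟩
    rw [addIndex, if_pos hil, hmap, Nat.add_sub_cancel]

end Remove

theorem isFishburn_zero : IsFishburn 0 0 :=
  ⟨by simp, by simp, by simp, by simp⟩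

theorem isIndexed_singleton : IsIndexed 1 0 {(0, 0)} where
  le := by simp
  lt := by simp
  row := by simp
  col := by simp
  mem := by simp
  min := by simp

theorem IsFishburn.eq_singleton {d : ℕ} {M : Multiset (ℕ × ℕ)} (h : IsFishburn d M)
    (hM : M.card = 1) : M = {(0, 0)} := by
  obtain ⟨⟨a, b⟩, rfl⟩ := Multiset.card_eq_one.1 hM
  have hd := h.lt a b (Multiset.mem_singleton_self _)
  obtain ⟨b', h1⟩ := h.row 0 (by omega)
  obtain ⟨a', h2⟩ := h.col 0 (by omega)
  simp only [Multiset.mem_singleton, Prod.mk.injEq] at h1 h2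
  rw [← h1.1, ← h2.2]

/-! ### Ascent sequences encode Fishburn matrices -/

theorem eq_nil_or_append_singleton (l : List ℕ) : l = [] ∨ ∃ m y, l = m ++ [y] := by
  induction l using List.reverseRecOn with
  | nil => exact Or.inl rfl
  | append_singleton l x => exact Or.inr ⟨l, x, rfl⟩

/-- The default last letter of the empty list is `0`; `hx` rules out a spurious ascent there. -/
theorem asc_concat (l : List ℕ) (x : ℕ) (hx : l = [] → x = 0) :
    asc (l ++ [x]) = asc l + if l.getLastD 0 < x then 1 else 0 := by
  rcases eq_nil_or_append_singleton l with rfl | ⟨m, y, rfl⟩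
  · simp [asc, hx rfl]
  · have e1 : (m ++ [y] ++ [x]).length - 1 = m.length + 1 := by simp
    have e2 : (m ++ [y]).length - 1 = m.length := by simp
    rw [asc, asc, e1, e2, Finset.range_add_one, Finset.filter_insert]
    have h1 : (m ++ [y] ++ [x]).getD m.length 0 = y := by simp
    have h2 : (m ++ [y] ++ [x]).getD (m.length + 1) 0 = x := by simp
    have h3 : (m ++ [y]).getLastD 0 = y := by simp
    have h4 : (Finset.range m.length).filter (fun j => (m ++ [y] ++ [x]).getD j 0 <
        (m ++ [y] ++ [x]).getD (j + 1) 0) = (Finset.range m.length).filter (fun j =>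
        (m ++ [y]).getD j 0 < (m ++ [y]).getD (j + 1) 0) := by
      refine Finset.filter_congr fun j hj => ?_
      rw [Finset.mem_range] at hj
      rw [List.getD_append (m ++ [y]) [x] 0 j (by simp; omega),
        List.getD_append (m ++ [y]) [x] 0 (j + 1) (by simpa using hj)]
    rw [h1, h2, h3, h4]
    split_ifs
    · rw [Finset.card_insert_of_notMem (by simp)]
    · rfl

theorem isAscentSeq_concat (l : List ℕ) (x : ℕ) :
    IsAscentSeq (l ++ [x]) ↔ IsAscentSeq l ∧ (l = [] → x = 0) ∧ x ≤ 1 + asc l := by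
  constructor
  · rintro ⟨h0, h1⟩
    refine ⟨⟨fun h => ?_, fun i h hi => ?_⟩, ?_, ?_⟩
    · have := h0 (by simp)
      rwa [List.getElem_append_left h] at this
    · have := h1 i (by simp; omega) hi
      rwa [List.getElem_append_left h, List.take_append_of_le_length h.le] at this
    · rintro rfl
      simpa using h0
    · cases l with
      | nil =>
        have := h0 (by simp)
        simp at this
        omega
      | cons y t =>
        have := h1 (y :: t).length (by simp) (by simp)
        simpa using this
  · rintro ⟨⟨h0, h1⟩, h2, h3⟩
    refine ⟨fun h => ?_, fun i h hi => ?_⟩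
    · cases l with
      | nil => simpa using h2 rfl
      | cons y t => simpa using h0
    · rcases Nat.lt_or_ge i l.length with h4 | h4
      · rw [List.getElem_append_left h4, List.take_append_of_le_length h4.le]
        exact h1 i h4 hi
      · obtain rfl : i = l.length := by simp at h; omega
        simpa using h3

/-- One step of the construction of a matrix from an ascent sequence; a state consists of a matrix,
its dimension and its index. -/
def codeStep (s : Multiset (ℕ × ℕ) × ℕ × ℕ) (x : ℕ) : Multiset (ℕ × ℕ) × ℕ × ℕ :=
  (addIndex s.2.1 s.2.2 s.1 x, if s.2.2 < x then s.2.1 + 1 else s.2.1, x)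

/-- The Fishburn matrix of an ascent sequence. -/
def code (l : List ℕ) : Multiset (ℕ × ℕ) :=
  -- The empty matrix is assigned dimension 1 and index 0, so that the first letter `0` creates `(0,
  -- 0)` without a shift and the dimension is always `asc + 1`.
  (l.foldl codeStep (0, 1, 0)).1

theorem foldl_codeStep (l : List ℕ) (hl : IsAscentSeq l) :
    l.foldl codeStep (0, 1, 0) = (code l, asc l + 1, l.getLastD 0) := by
  induction l using List.reverseRecOn with
  | nil => rfl
  | append_singleton l x ih =>
    rw [isAscentSeq_concat] at hl
    refine Prod.ext rfl ?_
    rw [List.foldl_append, ih hl.1, asc_concat _ _ hl.2.1]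
    simp only [List.foldl_cons, List.foldl_nil, codeStep]
    split_ifs <;> simp

theorem code_concat (l : List ℕ) (x : ℕ) (hl : IsAscentSeq l) :
    code (l ++ [x]) = addIndex (asc l + 1) (l.getLastD 0) (code l) x := by
  rw [code, List.foldl_append, foldl_codeStep l hl]
  rfl

theorem code_singleton : code [0] = {(0, 0)} := rfl

theorem isIndexed_code (l : List ℕ) (hl : IsAscentSeq l) (hne : l ≠ []) :
    IsIndexed (asc l + 1) (l.getLastD 0) (code l) := by
  induction l using List.reverseRecOn with
  | nil => exact absurd rfl hne
  | append_singleton l x ih =>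
    rw [isAscentSeq_concat] at hl
    by_cases h : l = []
    · subst h
      rw [hl.2.1 rfl]
      exact isIndexed_singleton
    · have h1 := (ih hl.1 h).isIndexed_addIndex (l := x) (by omega)
      rw [code_concat _ _ hl.1, asc_concat _ _ hl.2.1]
      convert! h1 using 1
      · split_ifs <;> rfl
      · simp

theorem card_code (l : List ℕ) (hl : IsAscentSeq l) : (code l).card = l.length := by
  induction l using List.reverseRecOn with
  | nil => rfl
  | append_singleton l x ih =>
    rw [isAscentSeq_concat] at hl
    rw [code_concat _ _ hl.1, card_addIndex, ih hl.1, List.length_append, List.length_singleton]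

theorem countP_code (l : List ℕ) (hl : IsAscentSeq l) :
    ((code l).countP fun q => q.1 = 0) = l.count 0 := by
  induction l using List.reverseRecOn with
  | nil => rfl
  | append_singleton l x ih =>
    rw [isAscentSeq_concat] at hl
    rw [code_concat _ _ hl.1, countP_addIndex, ih hl.1, List.count_append, List.count_singleton]
    simp

theorem code_injOn (n : ℕ) : Set.InjOn code (ascentSeqs n) := by
  induction n with
  | zero =>
    intro l hl l' hl' _
    rw [List.length_eq_zero_iff.1 hl.2, List.length_eq_zero_iff.1 hl'.2]
  | succ n ih =>
    intro l hl l' hl' heq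
    rcases eq_nil_or_append_singleton l with rfl | ⟨m, x, rfl⟩
    · simp [ascentSeqs] at hl
    rcases eq_nil_or_append_singleton l' with rfl | ⟨m', x', rfl⟩
    · simp [ascentSeqs] at hl'
    obtain ⟨hl, hn⟩ := hl
    obtain ⟨hl', hn'⟩ := hl'
    rw [isAscentSeq_concat] at hl hl'
    simp only [List.length_append, List.length_singleton, Nat.add_right_cancel_iff] at hn hn'
    cases n with
    | zero =>
      rw [hl.2.1 (List.length_eq_zero_iff.1 hn), hl'.2.1 (List.length_eq_zero_iff.1 hn'),
        List.length_eq_zero_iff.1 hn, List.length_eq_zero_iff.1 hn']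
    | succ n =>
      rw [code_concat _ _ hl.1, code_concat _ _ hl'.1] at heq
      obtain ⟨h1, rfl⟩ := addIndex_injective
        (isIndexed_code m hl.1 (by rintro rfl; simp at hn))
        (isIndexed_code m' hl'.1 (by rintro rfl; simp at hn')) (by omega) (by omega) heq
      rw [ih ⟨hl.1, hn⟩ ⟨hl'.1, hn'⟩ h1]

theorem code_surjOn (n : ℕ) : Set.SurjOn code (ascentSeqs n) (fishburnSet n) := by
  induction n with
  | zero =>
    rintro M ⟨hM, -⟩
    refine ⟨[], ⟨⟨by simp, by simp⟩, rfl⟩, ?_⟩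
    rw [Multiset.card_eq_zero.1 hM]
    rfl
  | succ n ih =>
    rintro B ⟨hB, d, hd⟩
    cases n with
    | zero =>
      refine ⟨[0], ⟨⟨by simp, ?_⟩, rfl⟩, by rw [hd.eq_singleton hB, code_singleton]⟩
      intro i h hi
      simp at h
      omega
    | succ n =>
      have hd0 : 0 < d := by
        obtain ⟨⟨a, b⟩, hab⟩ := Multiset.card_pos_iff_exists_mem.1 (by omega : 0 < B.card)
        have := hd.lt _ _ hab
        omega
      obtain ⟨x, hx⟩ := hd.exists_index hd0
      obtain ⟨e, i, M, hM, hxe, rfl⟩ := hx.exists_addIndex (by omega)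
      rw [card_addIndex, Nat.add_right_cancel_iff] at hB
      obtain ⟨l, ⟨hl, hn⟩, rfl⟩ := ih ⟨hB, e, hM.toIsFishburn⟩
      have hne : l ≠ [] := by rintro rfl; simp at hn
      have hidx := isIndexed_code l hl hne
      obtain rfl := hidx.dim_unique hM.toIsFishburn
      obtain rfl := hidx.index_unique hM
      refine ⟨l ++ [x], ⟨(isAscentSeq_concat _ _).2 ⟨hl, fun h => absurd h hne, by omega⟩,
        by simp [hn]⟩, code_concat _ _ hl⟩

theorem code_bijOn (n : ℕ) : Set.BijOn code (ascentSeqs n) (fishburnSet n) := by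
  refine ⟨?_, code_injOn n, code_surjOn n⟩
  rintro l ⟨hl, hn⟩
  refine ⟨(card_code l hl).trans hn, ?_⟩
  by_cases h : l = []
  · subst h
    exact ⟨0, isFishburn_zero⟩
  · exact ⟨_, (isIndexed_code l hl h).toIsFishburn⟩

theorem p_eq_ncard_ascentSeqs (n : ℕ) : p n = (ascentSeqs n).ncard := by
  rw [p_eq_ncard, ← (code_bijOn n).image_eq, (code_injOn n).ncard_image]

theorem pMin_eq_ncard_ascentSeqsZeros (n k : ℕ) :
    pMin n k = (ascentSeqsZeros n k).ncard := by
  have h1 : ascentSeqsZeros n k ⊆ ascentSeqs n := fun l hl => ⟨hl.1, hl.2.1⟩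
  rw [pMin_eq_ncard, ← ((code_injOn n).mono h1).ncard_image]
  congr 1
  ext M
  constructor
  · rintro ⟨hM, hk⟩
    obtain ⟨l, hl, rfl⟩ := code_surjOn n hM
    rw [countP_code l hl.1] at hk
    exact ⟨l, ⟨hl.1, hl.2, hk⟩, rfl⟩
  · rintro ⟨l, hl, rfl⟩
    exact ⟨(code_bijOn n).mapsTo (h1 hl), (countP_code l hl.1).trans hl.2.2⟩

/-! ### Prefixing a zero -/

/-- The step from `0` to a positive letter is one new ascent, which exactly pays for raising the
later letters by one. -/
theorem asc_zeroShift (l : List ℕ) (hl : IsAscentSeq l) :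
    asc (zeroShift l) = asc l + if l = [] then 0 else 1 := by
  induction l using List.reverseRecOn with
  | nil => rfl
  | append_singleton l x ih =>
    rw [isAscentSeq_concat] at hl
    have h1 : zeroShift (l ++ [x]) = zeroShift l ++ [x + 1] := by simp [zeroShift]
    rw [h1, asc_concat _ _ (by simp [zeroShift]), ih hl.1, asc_concat _ _ hl.2.1]
    rcases eq_nil_or_append_singleton l with rfl | ⟨m, y, rfl⟩
    · simp [zeroShift, hl.2.1]
    · have h2 : zeroShift (m ++ [y]) = (0 :: m.map (· + 1)) ++ [y + 1] := by simp [zeroShift]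
      rw [h2, List.getLastD_concat, List.getLastD_concat]
      simp only [List.append_eq_nil_iff, List.cons_ne_self, and_false, if_false]
      split_ifs <;> omega

theorem isAscentSeq_zeroShift_iff (l : List ℕ) : IsAscentSeq (zeroShift l) ↔ IsAscentSeq l := by
  induction l using List.reverseRecOn with
  | nil =>
    exact iff_of_true ((isAscentSeq_concat [] 0).2 (by simp [IsAscentSeq]))
      (by simp [IsAscentSeq])
  | append_singleton l x ih =>
    have h1 : zeroShift (l ++ [x]) = zeroShift l ++ [x + 1] := by simp [zeroShift]
    rw [h1, isAscentSeq_concat, isAscentSeq_concat, ih]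
    refine and_congr_right fun hl => ?_
    rw [asc_zeroShift l hl]
    by_cases h : l = []
    · subst h
      simp [zeroShift, asc]
      omega
    · simp [h, zeroShift]
      omega

theorem zeroShift_bijOn (n : ℕ) :
    Set.BijOn zeroShift (ascentSeqs n) (ascentSeqsZeros (n + 1) 1) := by
  refine ⟨?_, ?_, ?_⟩
  · rintro l ⟨hl, hn⟩
    refine ⟨(isAscentSeq_zeroShift_iff l).2 hl, by simp [zeroShift, hn], ?_⟩
    rw [zeroShift, List.count_cons_self, List.count_eq_zero_of_not_mem (by simp)]
  · intro l _ l' _ h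
    exact List.map_injective_iff.2 (add_left_injective 1) (List.cons.inj h).2
  · rintro (_ | ⟨x, l⟩) ⟨hl, hn, hk⟩
    · simp at hn
    · obtain rfl : x = 0 := hl.1 (by simp)
      rw [List.count_cons_self, Nat.add_eq_right, List.count_eq_zero] at hk
      have h1 : zeroShift (l.map (· - 1)) = 0 :: l := by
        rw [zeroShift, List.map_map]
        congr 1
        refine (List.map_congr_left fun y hy => ?_).trans (List.map_id l)
        have : y ≠ 0 := fun h => hk (h ▸ hy)
        simp only [Function.comp_apply, id_eq]
        omega
      refine ⟨l.map (· - 1), ⟨(isAscentSeq_zeroShift_iff _).1 (h1 ▸ hl), ?_⟩, h1⟩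
      simpa using hn

/-! ### Counting matrices column by column -/

open PowerSeries

/-- The multisets of size `n` with elements in `s`. -/
def multisetsOn {α : Type} [DecidableEq α] (s : Finset α) (n : ℕ) : Finset (Multiset α) :=
  (s.sym n).map ⟨Sym.toMultiset, Sym.coe_injective⟩

theorem mem_multisetsOn {α : Type} [DecidableEq α] {s : Finset α} {n : ℕ} {M : Multiset α} :
    M ∈ multisetsOn s n ↔ M.card = n ∧ ∀ a ∈ M, a ∈ s := by
  simp only [multisetsOn, Finset.mem_map, Finset.mem_sym_iff, Function.Embedding.coeFn_mk]
  constructor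
  · rintro ⟨m, hm, rfl⟩
    exact ⟨m.2, hm⟩
  · rintro ⟨h1, h2⟩
    exact ⟨⟨M, h1⟩, h2, rfl⟩

theorem card_multisetsOn {α : Type} [DecidableEq α] (s : Finset α) (n : ℕ) :
    (multisetsOn s n).card = s.card.multichoose n := by
  rw [multisetsOn, Finset.card_map]
  conv_lhs => rw [← s.attach_map_val, Finset.sym_map, Finset.card_map, Finset.attach_eq_univ,
    Finset.sym_univ, Finset.card_univ, Sym.card_sym_eq_multichoose, Fintype.card_coe]

theorem mk_multichoose_eq_invOneSubPow (a : ℕ) :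
    (PowerSeries.mk fun n => (a.multichoose n : ℤ)) = (invOneSubPow ℤ a).val := by
  cases a with
  | zero =>
    ext n
    rw [invOneSubPow_zero, coeff_mk, Units.val_one, coeff_one]
    cases n <;> simp
  | succ a =>
    ext n
    rw [invOneSubPow_val_succ_eq_mk_add_choose, coeff_mk, coeff_mk, Nat.multichoose_eq,
      show a + 1 + n - 1 = a + n by omega, Nat.choose_symm_add]

/-- The generating function of the nonempty multisets on a set of size `a`. -/
noncomputable def colWeight (a : ℕ) : PowerSeries ℤ :=
  (invOneSubPow ℤ a).val - 1

theorem colWeight_zero : colWeight 0 = 0 := by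
  rw [colWeight, invOneSubPow_zero, Units.val_one, sub_self]

theorem X_dvd_colWeight (a : ℕ) : X ∣ colWeight a := by
  rw [X_dvd_iff, colWeight, ← mk_multichoose_eq_invOneSubPow, map_sub]
  simp [← coeff_zero_eq_constantCoeff_apply]

theorem colWeight_mul (a : ℕ) : colWeight a * (1 - X) ^ a = 1 - (1 - X) ^ a := by
  rw [colWeight, sub_mul, one_mul, ← invOneSubPow_inv_eq_one_sub_pow, Units.val_inv]

theorem coeff_colWeight {α : Type} [DecidableEq α] (s : Finset α) (n : ℕ) :
    coeff n (colWeight s.card) = ((multisetsOn s n).filter (· ≠ 0)).card := by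
  rw [colWeight, ← mk_multichoose_eq_invOneSubPow, map_sub, coeff_mk, coeff_one,
    ← card_multisetsOn]
  split_ifs with h
  · subst h
    have h1 : multisetsOn s 0 = {0} := by
      ext M
      simp only [mem_multisetsOn, Multiset.card_eq_zero, Finset.mem_singleton]
      constructor
      · exact fun h => h.1
      · rintro rfl
        simp
    rw [h1, Finset.filter_singleton]
    simp
  · rw [sub_zero, Finset.filter_true_of_mem]
    intro M hM h0
    subst h0
    exact h (mem_multisetsOn.1 hM).1.symm

/-- The upper triangular matrices of dimension `d` and size `n` without zero columns whose rows
in `S` are zero. -/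
def colFull (d : ℕ) (S : Finset ℕ) (n : ℕ) : Finset (Multiset (ℕ × ℕ)) :=
  (multisetsOn ((Finset.range d ×ˢ Finset.range d).filter fun q => q.1 ≤ q.2 ∧ q.1 ∉ S) n).filter
    fun M => ∀ b ∈ Finset.range d, b ∈ M.map Prod.snd

theorem mem_colFull {d n : ℕ} {S : Finset ℕ} {M : Multiset (ℕ × ℕ)} :
    M ∈ colFull d S n ↔ M.card = n ∧ (∀ a b, (a, b) ∈ M → a ≤ b ∧ b < d ∧ a ∉ S) ∧
      ∀ b < d, ∃ a, (a, b) ∈ M := by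
  simp only [colFull, Finset.mem_filter, mem_multisetsOn, Finset.mem_product, Finset.mem_range,
    Multiset.mem_map, Prod.exists, exists_eq_right, Prod.forall, and_assoc]
  refine and_congr_right fun _ => and_congr_left fun _ => forall_congr' fun a =>
    forall_congr' fun b => forall_congr' fun _ => ?_
  constructor
  · rintro ⟨h1, h2, h3, h4⟩
    exact ⟨h3, h2, h4⟩
  · rintro ⟨h1, h2, h3⟩
    exact ⟨by omega, h2, h1, h3⟩

/-- Columns are independent: column `d` is any nonempty multiset of allowed rows, and the rest is a
matrix of dimension `d`. -/
theorem card_colFull_succ (d : ℕ) (S : Finset ℕ) (n : ℕ) :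
    (colFull (d + 1) S n).card = ∑ q ∈ Finset.HasAntidiagonal.antidiagonal n, (colFull d S q.1).card *
      ((multisetsOn (Finset.range (d + 1) \ S) q.2).filter (· ≠ 0)).card := by
  simp only [← Finset.card_product]
  rw [← Finset.card_sigma]
  refine Finset.card_nbij'
    (fun M => ⟨((M.filter fun q => q.2 < d).card, (M.filter fun q => ¬ q.2 < d).card),
      M.filter fun q => q.2 < d, (M.filter fun q => ¬ q.2 < d).map Prod.fst⟩)
    (fun x => x.2.1 + x.2.2.map fun a => (a, d)) ?_ ?_ ?_ ?_
  · intro M hM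
    rw [Finset.mem_coe, mem_colFull] at hM
    obtain ⟨h1, h2, h3⟩ := hM
    simp only [Finset.coe_sigma, Set.mem_sigma_iff, Finset.mem_coe, Finset.HasAntidiagonal.mem_antidiagonal,
      Finset.mem_product, mem_colFull, Finset.mem_filter, mem_multisetsOn, Multiset.card_map,
      Multiset.mem_filter, Multiset.mem_map, true_and, Finset.mem_sdiff, Finset.mem_range]
    refine ⟨?_, ⟨?_, ?_⟩, ?_, ?_⟩
    · rw [← Multiset.card_add, Multiset.filter_add_not, h1]
    · rintro a b ⟨hab, hb⟩
      have := h2 a b hab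
      exact ⟨this.1, hb, this.2.2⟩
    · intro b hb
      obtain ⟨a, ha⟩ := h3 b (by omega)
      exact ⟨a, ha, hb⟩
    · rintro a ⟨⟨a', b⟩, ⟨hab, hb⟩, rfl⟩
      have := h2 _ _ hab
      exact ⟨by dsimp only; omega, this.2.2⟩
    · obtain ⟨a, ha⟩ := h3 d (by omega)
      intro h0
      rw [Multiset.map_eq_zero, Multiset.filter_eq_nil] at h0
      exact h0 _ ha (lt_irrefl d)
  · rintro ⟨⟨i, j⟩, M, N⟩ hx
    simp only [Finset.coe_sigma, Set.mem_sigma_iff, Finset.mem_coe, Finset.HasAntidiagonal.mem_antidiagonal,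
      Finset.mem_product, mem_colFull, Finset.mem_filter, mem_multisetsOn, Finset.mem_sdiff,
      Finset.mem_range] at hx
    obtain ⟨h1, ⟨h2, h3, h4⟩, ⟨h5, h6⟩, h7⟩ := hx
    rw [Finset.mem_coe, mem_colFull]
    refine ⟨by simp [h1, h2, h5], ?_, ?_⟩
    · intro a b hab
      rcases Multiset.mem_add.1 hab with h | h
      · have := h3 a b h
        exact ⟨this.1, by omega, this.2.2⟩
      · obtain ⟨a', h8, h9⟩ := Multiset.mem_map.1 h
        cases h9
        have := h6 a h8
        exact ⟨by omega, by omega, this.2⟩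
    · intro b hb
      rcases Nat.lt_or_ge b d with h | h
      · obtain ⟨a, ha⟩ := h4 b h
        exact ⟨a, Multiset.mem_add.2 (Or.inl ha)⟩
      · obtain rfl : b = d := by omega
        obtain ⟨a, ha⟩ := Multiset.exists_mem_of_ne_zero h7
        exact ⟨a, Multiset.mem_add.2 (Or.inr (Multiset.mem_map.2 ⟨a, ha, rfl⟩))⟩
  · intro M hM
    rw [Finset.mem_coe, mem_colFull] at hM
    obtain ⟨h1, h2, h3⟩ := hM
    dsimp only
    conv_rhs => rw [← Multiset.filter_add_not (fun q : ℕ × ℕ => q.2 < d) M]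
    rw [Multiset.map_map]
    congr 1
    refine (Multiset.map_congr rfl fun q hq => ?_).trans (Multiset.map_id _)
    rw [Multiset.mem_filter] at hq
    have := h2 q.1 q.2 hq.1
    exact Prod.ext rfl (by simp only [Function.comp_apply, id_eq]; omega)
  · rintro ⟨⟨i, j⟩, M, N⟩ hx
    simp only [Finset.coe_sigma, Set.mem_sigma_iff, Finset.mem_coe, Finset.HasAntidiagonal.mem_antidiagonal,
      Finset.mem_product, mem_colFull, Finset.mem_filter, mem_multisetsOn] at hx
    obtain ⟨h1, ⟨h2, h3, h4⟩, ⟨h5, h6⟩, h7⟩ := hx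
    have e1 : (M + N.map fun a => (a, d)).filter (fun q => q.2 < d) = M := by
      rw [Multiset.filter_add, Multiset.filter_eq_self.2 fun q hq => (h3 q.1 q.2 hq).2.1,
        Multiset.filter_eq_nil.2, add_zero]
      simp
    have e2 : (M + N.map fun a => (a, d)).filter (fun q => ¬ q.2 < d) =
        N.map fun a => (a, d) := by
      rw [Multiset.filter_add, Multiset.filter_eq_nil.2, zero_add, Multiset.filter_eq_self.2]
      · simp
      · exact fun q hq => not_not.2 (h3 q.1 q.2 hq).2.1
    dsimp only
    rw [e1, e2, Multiset.card_map, Multiset.map_map, h2, h5]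
    simp

/-- The generating function of `colFull d S`. -/
noncomputable def colFullGen (d : ℕ) (S : Finset ℕ) : PowerSeries ℤ :=
  PowerSeries.mk fun n => ((colFull d S n).card : ℤ)

theorem colFullGen_zero (S : Finset ℕ) : colFullGen 0 S = 1 := by
  ext n
  rw [colFullGen, coeff_mk, coeff_one]
  have h : colFull 0 S n = if n = 0 then {0} else ∅ := by
    ext M
    rw [mem_colFull]
    have : (∀ a b, (a, b) ∈ M → a ≤ b ∧ b < 0 ∧ a ∉ S) ↔ M = 0 := by
      rw [Multiset.eq_zero_iff_forall_notMem, Prod.forall]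
      simp
    rw [this]
    split_ifs with h
    · simp [h]
    · simp only [Finset.notMem_empty, iff_false]
      rintro ⟨rfl, rfl, -⟩
      exact h rfl
  rw [h]
  split_ifs <;> rfl

theorem colFullGen_succ (d : ℕ) (S : Finset ℕ) :
    colFullGen (d + 1) S = colFullGen d S * colWeight (Finset.range (d + 1) \ S).card := by
  ext n
  rw [colFullGen, coeff_mk, card_colFull_succ, coeff_mul, Nat.cast_sum]
  refine Finset.sum_congr rfl fun q _ => ?_
  rw [Nat.cast_mul, coeff_colWeight, colFullGen, coeff_mk]

theorem colFull_insert (d : ℕ) (S : Finset ℕ) (n : ℕ) :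
    colFull d (insert d S) n = colFull d S n := by
  ext M
  rw [mem_colFull, mem_colFull]
  refine and_congr_right fun _ => and_congr_left fun _ => forall_congr' fun a =>
    forall_congr' fun b => forall_congr' fun _ => and_congr_right fun h => and_congr_right fun h' => ?_
  rw [Finset.mem_insert, not_or]
  exact and_iff_right (by omega)

/-! ### Inclusion-exclusion over zero rows -/

/-- The part of the inclusion-exclusion sum over the sets of zero rows in which `a` rows are
unconstrained. -/
noncomputable def signedGen (d a : ℕ) : PowerSeries ℤ :=
  ∑ S ∈ (Finset.range d).powerset, if S.card + a = d then (-1) ^ S.card * colFullGen d S else 0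

theorem signedGen_zero (a : ℕ) : signedGen 0 a = if a = 0 then 1 else 0 := by
  simp [signedGen, colFullGen_zero]

/-- The last column sees exactly `a` free rows. If row `d` is free, `a - 1` free rows remain among
the others; if it lies in `S`, all `a` remain and the sign flips. -/
theorem signedGen_succ (d a : ℕ) : signedGen (d + 1) a =
    colWeight a * ((if a = 0 then 0 else signedGen d (a - 1)) - signedGen d a) := by
  have hcard : ∀ S ∈ (Finset.range d).powerset, S.card ≤ d ∧ d ∉ S := fun S hS => by
    rw [Finset.mem_powerset] at hS
    exact ⟨by simpa using Finset.card_le_card hS, fun h => by simpa using hS h⟩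
  rw [signedGen, Finset.range_add_one, Finset.sum_powerset_insert Finset.notMem_range_self,
    mul_sub, sub_eq_add_neg]
  congr 1
  · split_ifs with ha
    · rw [mul_zero]
      refine Finset.sum_eq_zero fun S hS => if_neg ?_
      have := hcard S hS
      omega
    · rw [signedGen, Finset.mul_sum]
      refine Finset.sum_congr rfl fun S hS => ?_
      have := hcard S hS
      by_cases h : S.card + a = d + 1
      · rw [if_pos h, if_pos (by omega), colFullGen_succ, Finset.card_sdiff_of_subset
          ((Finset.mem_powerset.1 hS).trans (Finset.range_mono (by omega))), Finset.card_range,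
          show d + 1 - S.card = a by omega]
        ring
      · rw [if_neg h, if_neg (by omega), mul_zero]
  · rw [signedGen, Finset.mul_sum, ← Finset.sum_neg_distrib]
    refine Finset.sum_congr rfl fun S hS => ?_
    have := hcard S hS
    rw [Finset.card_insert_of_notMem this.2]
    by_cases h : S.card + a = d
    · have h1 : colFullGen d (insert d S) = colFullGen d S := by
        simp only [colFullGen, colFull_insert]
      rw [if_pos (by omega), if_pos h, colFullGen_succ, Finset.card_sdiff_of_subset
        (by rw [Finset.range_add_one]; exact Finset.insert_subset_insert _ (Finset.mem_powerset.1 hS)),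
        Finset.card_range, Finset.card_insert_of_notMem this.2, h1,
        show d + 1 - (S.card + 1) = a by omega]
      ring
    · rw [if_neg (by omega), if_neg h, mul_zero, neg_zero]

/-- The summand of the generating function of the Fishburn numbers. -/
noncomputable def fishburnTerm (a : ℕ) : PowerSeries ℤ :=
  ∏ i ∈ Finset.Icc 1 a, (1 - (1 - X) ^ i)

theorem fishburnTerm_succ (a : ℕ) :
    fishburnTerm (a + 1) = colWeight (a + 1) * (fishburnTerm a - fishburnTerm (a + 1)) := by
  have h : fishburnTerm (a + 1) = fishburnTerm a * (1 - (1 - X) ^ (a + 1)) := by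
    rw [fishburnTerm, Finset.prod_Icc_succ_top (by omega), fishburnTerm]
  rw [h]
  linear_combination fishburnTerm a * (- colWeight_mul (a + 1))

theorem X_pow_dvd_fishburnTerm (a : ℕ) : X ^ a ∣ fishburnTerm a := by
  induction a with
  | zero => simp
  | succ a ih =>
    rw [fishburnTerm, Finset.prod_Icc_succ_top (by omega), pow_succ]
    refine mul_dvd_mul ih ?_
    rw [← colWeight_mul]
    exact (X_dvd_colWeight _).mul_right _

/-- By `fishburnTerm_succ` both sides obey the same recursion, and each use multiplies the errors by
a `colWeight`, which is divisible by `X`: every further dimension gains one order of precision. -/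
theorem X_pow_dvd_sum_signedGen_sub (D a : ℕ) :
    X ^ (D + 1) ∣ (∑ d ∈ Finset.range (D + 1), signedGen d a) - fishburnTerm a := by
  induction D generalizing a with
  | zero =>
    rw [zero_add, Finset.sum_range_one, signedGen_zero, pow_one]
    split_ifs with h
    · simp [h, fishburnTerm]
    · rw [zero_sub, dvd_neg]
      exact (dvd_pow_self X h).trans (X_pow_dvd_fishburnTerm a)
  | succ D ih =>
    rw [Finset.sum_range_succ', signedGen_zero]
    simp only [signedGen_succ]
    cases a with
    | zero => simp [colWeight_zero, fishburnTerm]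
    | succ a =>
      simp only [Nat.add_eq_zero_iff, one_ne_zero, and_false, if_false, add_zero,
        Nat.add_sub_cancel]
      rw [← Finset.mul_sum, Finset.sum_sub_distrib]
      have h : ∀ x y : PowerSeries ℤ, colWeight (a + 1) * (x - y) - fishburnTerm (a + 1) =
          ((x - fishburnTerm a) - (y - fishburnTerm (a + 1))) * colWeight (a + 1) := by
        intro x y
        linear_combination - fishburnTerm_succ a
      rw [h, pow_succ]
      exact mul_dvd_mul ((ih a).sub (ih (a + 1))) (X_dvd_colWeight _)

open Classical in
/-- The Fishburn matrices of dimension `d` and size `n`. -/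
noncomputable def fishburnFinset (d n : ℕ) : Finset (Multiset (ℕ × ℕ)) :=
  (colFull d ∅ n).filter (IsFishburn d)

theorem mem_fishburnFinset {d n : ℕ} {M : Multiset (ℕ × ℕ)} :
    M ∈ fishburnFinset d n ↔ M.card = n ∧ IsFishburn d M := by
  classical
  rw [fishburnFinset, Finset.mem_filter, mem_colFull]
  constructor
  · exact fun h => ⟨h.1.1, h.2⟩
  · exact fun h => ⟨⟨h.1, fun a b hab => ⟨h.2.le _ _ hab, h.2.lt _ _ hab, by simp⟩, h.2.col⟩, h.2⟩

/-- For each matrix, the alternating sum over subsets of its set `Z M` of zero rows vanishes unless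
that set is empty. -/
theorem card_fishburnFinset (d n : ℕ) : ((fishburnFinset d n).card : ℤ) =
    ∑ S ∈ (Finset.range d).powerset, (-1) ^ S.card * ((colFull d S n).card : ℤ) := by
  classical
  let Z : Multiset (ℕ × ℕ) → Finset ℕ := fun M =>
    (Finset.range d).filter fun a => a ∉ M.map Prod.fst
  have memZ : ∀ M a, a ∈ Z M ↔ a < d ∧ ∀ b, (a, b) ∉ M := fun M a => by simp [Z]
  have h1 : ∀ S ∈ (Finset.range d).powerset,
      colFull d S n = (colFull d ∅ n).filter (S ⊆ Z ·) := by
    intro S hS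
    rw [Finset.mem_powerset] at hS
    ext M
    simp only [Finset.mem_filter, mem_colFull]
    constructor
    · rintro ⟨h2, h3, h4⟩
      refine ⟨⟨h2, fun a b hab => ⟨(h3 a b hab).1, (h3 a b hab).2.1, by simp⟩, h4⟩, fun a ha => ?_⟩
      exact (memZ M a).2 ⟨Finset.mem_range.1 (hS ha), fun b hab => (h3 a b hab).2.2 ha⟩
    · rintro ⟨⟨h2, h3, h4⟩, h5⟩
      exact ⟨h2, fun a b hab => ⟨(h3 a b hab).1, (h3 a b hab).2.1,
        fun ha => ((memZ M a).1 (h5 ha)).2 b hab⟩, h4⟩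
  have h2 : fishburnFinset d n = (colFull d ∅ n).filter (Z · = ∅) := by
    rw [fishburnFinset]
    refine Finset.filter_congr fun M hM => ?_
    obtain ⟨-, h3, h4⟩ := mem_colFull.1 hM
    rw [Finset.eq_empty_iff_forall_notMem]
    constructor
    · intro h a ha
      obtain ⟨b, hb⟩ := h.row a ((memZ M a).1 ha).1
      exact ((memZ M a).1 ha).2 b hb
    · intro h
      refine ⟨fun a b hab => (h3 a b hab).1, fun a b hab => (h3 a b hab).2.1, fun a ha => ?_, h4⟩
      by_contra! hne
      exact h a ((memZ M a).2 ⟨ha, hne⟩)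
  have h3 : ∀ S ∈ (Finset.range d).powerset, (-1) ^ S.card * ((colFull d S n).card : ℤ) =
      ∑ M ∈ colFull d ∅ n, if S ⊆ Z M then (-1 : ℤ) ^ S.card else 0 := by
    intro S hS
    rw [← Finset.sum_filter, ← h1 S hS, Finset.sum_const, nsmul_eq_mul, mul_comm]
  rw [Finset.sum_congr rfl h3, Finset.sum_comm, h2, Finset.card_filter, Nat.cast_sum]
  refine Finset.sum_congr rfl fun M _ => ?_
  rw [← Finset.sum_filter]
  have h4 : (Finset.range d).powerset.filter (· ⊆ Z M) = (Z M).powerset := by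
    ext S
    simp only [Finset.mem_filter, Finset.mem_powerset, and_iff_right_iff_imp]
    exact fun h => h.trans (Finset.filter_subset _ _)
  rw [h4, Finset.sum_powerset_neg_one_pow_card]
  push_cast
  rfl

theorem card_fishburnFinset_eq_coeff {d n : ℕ} (h : d ≤ n) : ((fishburnFinset d n).card : ℤ) =
    ∑ a ∈ Finset.range (n + 1), coeff n (signedGen d a) := by
  rw [card_fishburnFinset, ← map_sum]
  simp only [signedGen]
  rw [Finset.sum_comm, map_sum]
  refine Finset.sum_congr rfl fun S hS => ?_
  have hS' : S.card ≤ d := by simpa using Finset.card_le_card (Finset.mem_powerset.1 hS)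
  -- Each `S` contributes to the single value `a = d - S.card`, which is in range because `d ≤ n`.
  rw [Finset.sum_eq_single_of_mem (d - S.card) (Finset.mem_range.2 (by omega))
    fun a _ ha => if_neg (by omega), if_pos (by omega), colFullGen,
    show (-1 : PowerSeries ℤ) ^ S.card = C ((-1) ^ S.card) by simp, coeff_C_mul, coeff_mk]

theorem IsFishburn.dim_le_card {d : ℕ} {M : Multiset (ℕ × ℕ)} (h : IsFishburn d M) :
    d ≤ M.card := by
  have h1 : Finset.range d ⊆ (M.map Prod.fst).toFinset := fun a ha => by
    obtain ⟨b, hb⟩ := h.row a (Finset.mem_range.1 ha)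
    exact Multiset.mem_toFinset.2 (Multiset.mem_map_of_mem Prod.fst hb)
  have h2 := (Finset.card_le_card h1).trans (Multiset.toFinset_card_le _)
  simpa using h2

theorem ncard_fishburnSet (n : ℕ) :
    (fishburnSet n).ncard = ∑ d ∈ Finset.range (n + 1), (fishburnFinset d n).card := by
  classical
  have h : fishburnSet n = ((Finset.range (n + 1)).biUnion fun d => fishburnFinset d n :
      Finset (Multiset (ℕ × ℕ))) := by
    ext M
    simp only [Finset.coe_biUnion, Set.mem_iUnion, Finset.mem_coe, mem_fishburnFinset,
      Finset.mem_range]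
    constructor
    · rintro ⟨h1, d, hd⟩
      exact ⟨d, by have := hd.dim_le_card; omega, h1, hd⟩
    · rintro ⟨d, -, h1, hd⟩
      exact ⟨h1, d, hd⟩
  rw [h, Set.ncard_coe_finset, Finset.card_biUnion]
  intro d _ e _ hde
  refine Finset.disjoint_left.2 fun M hM hM' => ?_
  exact hde ((mem_fishburnFinset.1 hM).2.dim_unique (mem_fishburnFinset.1 hM').2)

/-! ### The generating function identities -/

theorem p_eq_sum_coeff (n : ℕ) :
    (p n : ℤ) = ∑ a ∈ Finset.range (n + 1), coeff n (fishburnTerm a) := by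
  rw [p_eq_ncard, ncard_fishburnSet, Nat.cast_sum, Finset.sum_congr rfl fun d hd =>
    card_fishburnFinset_eq_coeff (Nat.lt_succ_iff.1 (Finset.mem_range.1 hd)), Finset.sum_comm]
  refine Finset.sum_congr rfl fun a _ => ?_
  have h := X_pow_dvd_iff.1 (X_pow_dvd_sum_signedGen_sub n a) n (by omega)
  rwa [map_sub, sub_eq_zero, map_sum] at h

theorem hasSum_fishburnTerm : HasSum fishburnTerm genP := by
  rw [PowerSeries.WithPiTopology.hasSum_iff_hasSum_coeff]
  intro n
  rw [genP, coeff_mk, p_eq_sum_coeff]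
  refine hasSum_sum_of_ne_finset_zero fun a ha => ?_
  exact X_pow_dvd_iff.1 (X_pow_dvd_fishburnTerm a) n (by simpa using ha)

theorem pMin_succ_one (n : ℕ) : pMin (n + 1) 1 = p n := by
  rw [pMin_eq_ncard_ascentSeqsZeros, p_eq_ncard_ascentSeqs, ← (zeroShift_bijOn n).image_eq,
    (zeroShift_bijOn n).injOn.ncard_image]

theorem pMin_zero_one : pMin 0 1 = 0 := by
  rw [pMin_eq_ncard_ascentSeqsZeros]
  have : ascentSeqsZeros 0 1 = ∅ := by
    rw [Set.eq_empty_iff_forall_notMem]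
    rintro l ⟨-, h1, h2⟩
    rw [List.length_eq_zero_iff.1 h1] at h2
    simp at h2
  rw [this, Set.ncard_empty]

theorem X_mul_genP : PowerSeries.X * genP =
    PowerSeries.constantCoeff (PowerSeries.derivative (PowerSeries ℤ) genPz) := by
  rw [← coeff_zero_eq_constantCoeff_apply, coeff_derivative, genPz, coeff_mk, zero_add,
    Nat.cast_zero, zero_add, mul_one]
  ext n
  cases n with
  | zero => rw [coeff_zero_X_mul, coeff_mk, pMin_zero_one, Nat.cast_zero]
  | succ n => rw [coeff_succ_X_mul, coeff_mk, pMin_succ_one, genP, coeff_mk]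

end TwoPlusTwo

theorem mainTheorem3 :
    -- the number of (2+2)-free posets of size `n` (with `k` minimal elements) is the number of
    -- ascent sequences of length `n` (with `k` zeros)
    (∀ n : ℕ, TwoPlusTwo.p n = (TwoPlusTwo.ascentSeqs n).ncard) ∧
    (∀ n k : ℕ, TwoPlusTwo.pMin n k = (TwoPlusTwo.ascentSeqsZeros n k).ncard) ∧
    -- the bijection between ascent sequences of length `n` and those of length `n + 1`
    -- with exactly one zero
    (∀ n : ℕ, Set.BijOn TwoPlusTwo.zeroShift
      (TwoPlusTwo.ascentSeqs n) (TwoPlusTwo.ascentSeqsZeros (n + 1) 1)) ∧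
    -- `t P(t) = ∂_z P(t, z)` at `z = 0`
    (PowerSeries.X * TwoPlusTwo.genP =
      PowerSeries.constantCoeff
        (PowerSeries.derivative (PowerSeries ℤ) TwoPlusTwo.genPz)) ∧
    -- `P(t) = ∑ₙ ∏ᵢ (1 - (1 - t)^i)`, a convergent sum of formal power series
    HasSum (fun n : ℕ => ∏ i ∈ Finset.Icc 1 n, (1 - (1 - (PowerSeries.X : PowerSeries ℤ)) ^ i))
      TwoPlusTwo.genP := by
  refine ⟨TwoPlusTwo.p_eq_ncard_ascentSeqs, TwoPlusTwo.pMin_eq_ncard_ascentSeqsZeros,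
    TwoPlusTwo.zeroShift_bijOn, TwoPlusTwo.X_mul_genP, ?_⟩
  exact TwoPlusTwo.hasSum_fishburnTerm
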